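/- Let $a < -1$ be a real number and let $k$ be an odd positive integer. Let $M((a,-1))$ denote the space of all finite real (that is, positive or signed) regular Borel measures on the open interval $(a,-1)$; equivalently, of all real Borel measures $\mu$ on $\mathbb{R}$ of finite total variation with $|\mu|(\mathbb{R} \setminus (a,-1)) = 0$. Then for every nonzero $\mu \in M((a,-1))$ we have \[ \sup_{n \geq 0} \int x^{kn} \, d\mu = \infty \quad \text{and} \quad \inf_{n \geq 0} \int x^{kn} \, d\mu = -\infty . \] -/

import Mathlib

/-- The space `M(S)` of finite real (signed) regular Borel measures carried by `S ⊆ ℝ`, realised as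
the Borel signed measures `μ` on `ℝ` with `|μ|(ℝ \ S) = 0`. A Mathlib `SignedMeasure` is real-valued,
so it has finite total variation, and finite Borel measures on `ℝ` are automatically regular. -/
def realMeasuresOn (S : Set ℝ) : Set (MeasureTheory.SignedMeasure ℝ) :=
  {μ | μ.totalVariation Sᶜ = 0}

open MeasureTheory Filter Topology Set

/-! Put `f = x ^ k`, which is negative because `k` is odd, and suppose its moments `m n` are at most
`C`. In `C * exp t - ∫ exp (t * f) = ∑ t ^ n / n! * (C - m n)` every term is nonnegative, and for `t
≥ 0` the integral is at most the total variation. Each term is therefore `O(exp t)`, and `t = n`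
gives `|m n| = O(n)` (`exists_abs_moment_le_of_moment_le`). For `t < -1` the moments of `g = f / t ^
k` then tend to `0`. Evaluating the limit of `∫ exp (-c * g ^ N)` both termwise and pointwise gives
`μ {g ≥ 1} = 0`, that is, `μ (Iic t) = 0`. These half-lines determine `μ`, so `μ = 0`. -/

instance MeasureTheory.SignedMeasure.isFiniteMeasure_variation {X : Type*} [MeasurableSpace X]
    (μ : SignedMeasure X) : IsFiniteMeasure μ.variation := by
  rw [← SignedMeasure.totalVariation_eq_variation]
  unfold SignedMeasure.totalVariation
  infer_instance

/-- A signed measure vanishes on sets of zero variation. -/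
theorem MeasureTheory.SignedMeasure.apply_eq_zero_of_variation_eq_zero {X : Type*}
    [MeasurableSpace X] (μ : SignedMeasure X) {s : Set X} (hs : μ.variation s = 0) : μ s = 0 := by
  have h := SignedMeasure.enorm_le_totalVariation μ s
  rw [SignedMeasure.totalVariation_eq_variation, hs] at h
  simpa using h

section Moments

variable {X : Type*} [MeasurableSpace X] {μ : SignedMeasure X} {f : X → ℝ} {b : ℝ}

/-- Integrating the exponential series termwise. -/
theorem hasSum_integral_exp (hf : Measurable f) (hb : ∀ᵐ x ∂μ.variation, |f x| ≤ b) (c : ℝ) :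
    HasSum (fun n : ℕ ↦ c ^ n / n.factorial * ∫ᵛ x, f x ^ n ∂•μ)
      (∫ᵛ x, Real.exp (c * f x) ∂•μ) := by
  have hexp (y : ℝ) : HasSum (fun n : ℕ ↦ y ^ n / n.factorial) (Real.exp y) := by
    rw [Real.exp_eq_exp_ℝ]
    exact NormedSpace.expSeries_div_hasSum_exp y
  have key : HasSum (fun n : ℕ ↦ ∫ᵛ x, (c ^ n / n.factorial) • f x ^ n ∂•μ)
      (∫ᵛ x, Real.exp (c * f x) ∂•μ) := by
    refine VectorMeasure.hasSum_integral_of_dominated_convergence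
      (fun n _ ↦ (|c| * b) ^ n / n.factorial)
      (fun n ↦ ((hf.pow_const n).const_mul _).aestronglyMeasurable) (fun n ↦ ?_)
      (.of_forall fun _ ↦ (hexp _).summable) (integrable_const _) (.of_forall fun x ↦ ?_)
    · filter_upwards [hb] with x hx
      rw [smul_eq_mul, norm_mul, norm_div, Real.norm_natCast, norm_pow, norm_pow, Real.norm_eq_abs,
        Real.norm_eq_abs, mul_pow, div_mul_eq_mul_div]
      gcongr
    · refine (hexp (c * f x)).congr_fun fun n ↦ ?_
      rw [smul_eq_mul, mul_pow]
      ring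
  simp only [VectorMeasure.integral_fun_smul] at key
  exact key

theorem abs_integral_le (μ : SignedMeasure X) {g : X → ℝ} {C : ℝ} (hC : 0 ≤ C)
    (h : ∀ᵐ x ∂μ.variation, |g x| ≤ C) : |∫ᵛ x, g x ∂•μ| ≤ C * μ.variation.real univ := by
  have h1 := VectorMeasure.norm_integral_le_of_norm_le_const
    (B := ContinuousLinearMap.lsmul ℝ ℝ) (μ := μ) h
  refine h1.trans ?_
  have : ‖(ContinuousLinearMap.lsmul ℝ ℝ : ℝ →L[ℝ] ℝ →L[ℝ] ℝ)‖ ≤ 1 :=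
    ContinuousLinearMap.opNorm_lsmul_le
  have h0 : 0 ≤ μ.variation.real univ := measureReal_nonneg
  nlinarith [mul_nonneg hC h0]

/-- A crude Stirling bound; the factor `n + 1` in place of `n` covers `n = 0`. -/
theorem factorial_mul_exp_le (n : ℕ) :
    (n.factorial : ℝ) * Real.exp n ≤ Real.exp 1 * (n + 1) * (n : ℝ) ^ n := by
  rcases Nat.eq_zero_or_pos n with rfl | hn
  · simp
  suffices h : (n.factorial : ℝ) * Real.exp n ≤ Real.exp 1 * n * (n : ℝ) ^ n by
    refine h.trans ?_
    gcongr
    linarith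
  induction n, hn using Nat.le_induction with
  | base => simp
  | succ n hn ih =>
    have hn' : (0 : ℝ) < n := by exact_mod_cast hn
    -- This is `e ≤ (1 + 1 / n) ^ (n + 1)`.
    have h1 : Real.exp 1 * (n : ℝ) ^ (n + 1) ≤ ((n : ℝ) + 1) ^ (n + 1) := by
      have h2 : (n : ℝ) * Real.exp (1 / (n + 1)) ≤ n + 1 := by
        have h3 := Real.add_one_le_exp (-(1 / ((n : ℝ) + 1)))
        have h4 : -(1 / ((n : ℝ) + 1)) + 1 = n / (n + 1) := by field_simp; ring
        rw [h4, Real.exp_neg, le_inv_comm₀ (by positivity) (by positivity), inv_div,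
          le_div_iff₀ hn'] at h3
        linarith
      calc Real.exp 1 * (n : ℝ) ^ (n + 1) = (n * Real.exp (1 / (n + 1))) ^ (n + 1) := by
            rw [mul_pow, ← Real.exp_nat_mul]
            push_cast
            rw [mul_one_div_cancel (by positivity), mul_comm]
        _ ≤ _ := by gcongr
    calc ((n + 1).factorial : ℝ) * Real.exp ((n + 1 : ℕ) : ℝ)
        = (n + 1) * Real.exp 1 * (n.factorial * Real.exp n) := by
          rw [Nat.factorial_succ]; push_cast; rw [Real.exp_add]; ring
      _ ≤ (n + 1) * Real.exp 1 * (Real.exp 1 * n * (n : ℝ) ^ n) := by gcongr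
      _ = (n + 1) * Real.exp 1 * (Real.exp 1 * (n : ℝ) ^ (n + 1)) := by ring
      _ ≤ (n + 1) * Real.exp 1 * ((n : ℝ) + 1) ^ (n + 1) := by gcongr
      _ = _ := by push_cast; ring

/-- If the moments of a bounded nonpositive function are bounded above, then they grow at most
linearly. -/
theorem exists_abs_moment_le_of_moment_le (hf : Measurable f)
    (hb : ∀ᵐ x ∂μ.variation, -b ≤ f x ∧ f x ≤ 0) {C : ℝ}
    (hC : ∀ n : ℕ, ∫ᵛ x, f x ^ n ∂•μ ≤ C) :
    ∃ K, ∀ n : ℕ, |∫ᵛ x, f x ^ n ∂•μ| ≤ K * (n + 1) := by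
  set m : ℕ → ℝ := fun n ↦ ∫ᵛ x, f x ^ n ∂•μ with hm
  set V := μ.variation.real univ
  have hV : 0 ≤ V := measureReal_nonneg
  have hbound (n : ℕ) : C - m n ≤ (|C| + V) * (Real.exp 1 * (n + 1)) := by
    -- `t = n` minimises `exp t / t ^ n`.
    set t : ℝ := (n : ℝ) with ht
    have ht0 : 0 ≤ t := n.cast_nonneg
    have h1 := hasSum_integral_exp (c := t) hf
      (hb.mono fun x hx ↦ abs_le.2 ⟨hx.1, by linarith [hx.1, hx.2]⟩)
    have h2 : HasSum (fun j : ℕ ↦ t ^ j / j.factorial) (Real.exp t) := by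
      rw [Real.exp_eq_exp_ℝ]
      exact NormedSpace.expSeries_div_hasSum_exp t
    have h3 := (h2.mul_left C).sub h1
    -- A single term is at most the sum, as all terms are nonnegative.
    have h4 := le_hasSum h3 n fun j _ ↦ by
      rw [mul_comm C, ← mul_sub]
      exact mul_nonneg (by positivity) (sub_nonneg.2 (hC j))
    rw [mul_comm C, ← mul_sub] at h4
    have h5 : |∫ᵛ x, Real.exp (t * f x) ∂•μ| ≤ 1 * V := by
      refine abs_integral_le μ zero_le_one (hb.mono fun x hx ↦ ?_)
      rw [Real.abs_exp, Real.exp_le_one_iff]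
      exact mul_nonpos_of_nonneg_of_nonpos ht0 hx.2
    have h6 : t ^ n / n.factorial * (C - m n) ≤ (|C| + V) * Real.exp t := by
      have := Real.one_le_exp ht0
      have := mul_le_mul_of_nonneg_right (le_abs_self C) (Real.exp_pos t).le
      have := (abs_le.1 h5).1
      have := mul_nonneg hV (sub_nonneg.2 (Real.one_le_exp ht0))
      simp only [hm]
      nlinarith
    have htn : 0 < t ^ n := by
      rcases Nat.eq_zero_or_pos n with rfl | hn
      · simp
      · have : 0 < t := by simpa [ht] using hn
        positivity
    have hfac : (0 : ℝ) < n.factorial := by exact_mod_cast n.factorial_pos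
    have h7 := factorial_mul_exp_le n
    rw [← ht] at h7
    rw [div_mul_eq_mul_div, div_le_iff₀ hfac] at h6
    refine le_of_mul_le_mul_left ?_ htn
    calc t ^ n * (C - m n) ≤ (|C| + V) * (n.factorial * Real.exp t) := by linarith
      _ ≤ (|C| + V) * (Real.exp 1 * (t + 1) * t ^ n) := by gcongr
      _ = _ := by ring
  refine ⟨(|C| + V) * Real.exp 1 + |C|, fun n ↦ abs_le.2 ⟨?_, ?_⟩⟩
  · have h1 := hbound n
    have h2 := neg_abs_le C
    have h3 : 0 ≤ |C| * n := by positivity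
    change _ ≤ m n
    nlinarith
  · have h2 := le_abs_self C
    have h3 : 0 ≤ |C| * n := by positivity
    have h4 : 0 ≤ (|C| + V) * Real.exp 1 * (n + 1) := by positivity
    have := hC n
    nlinarith

/-- If the moments of a bounded nonnegative function tend to zero, the integrals of
`exp (-c f ^ N)` tend to the total mass. -/
theorem tendsto_integral_exp_neg_pow (hf : Measurable f)
    (hb : ∀ᵐ x ∂μ.variation, 0 ≤ f x ∧ f x ≤ b)
    (h : Tendsto (fun n : ℕ ↦ ∫ᵛ x, f x ^ n ∂•μ) atTop (𝓝 0)) (c : ℝ) :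
    Tendsto (fun N : ℕ ↦ ∫ᵛ x, Real.exp (c * f x ^ N) ∂•μ) atTop (𝓝 (μ univ)) := by
  obtain ⟨D, hD⟩ := h.abs.bddAbove_range
  have hsum (N : ℕ) : HasSum (fun j : ℕ ↦ c ^ j / j.factorial * ∫ᵛ x, f x ^ (N * j) ∂•μ)
      (∫ᵛ x, Real.exp (c * f x ^ N) ∂•μ) := by
    simpa only [pow_mul] using hasSum_integral_exp (b := b ^ N) (hf.pow_const N)
      (hb.mono fun x hx ↦ by
        rw [abs_of_nonneg (pow_nonneg hx.1 N)]
        exact pow_le_pow_left₀ hx.1 hx.2 N) c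
  -- Only `j = 0` survives, where the integrand is `1` for every `N`.
  have hlim : Tendsto (fun N : ℕ ↦ ∑' j : ℕ, c ^ j / j.factorial * ∫ᵛ x, f x ^ (N * j) ∂•μ) atTop
      (𝓝 (∑' j : ℕ, if j = 0 then μ univ else 0)) := by
    refine tendsto_tsum_of_dominated_convergence (bound := fun j ↦ |c| ^ j / j.factorial * D)
      ((Real.summable_pow_div_factorial |c|).mul_right D) (fun j ↦ ?_)
      (.of_forall fun N j ↦ ?_)
    · rcases Nat.eq_zero_or_pos j with rfl | hj
      · simp [VectorMeasure.integral_const]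
      · simpa [hj.ne'] using (h.comp (tendsto_id.atTop_mul_const' hj)).const_mul
          (c ^ j / (j.factorial : ℝ))
    · rw [norm_mul, norm_div, norm_pow, Real.norm_eq_abs, Real.norm_natCast]
      gcongr
      exact hD ⟨N * j, rfl⟩
  rw [tsum_ite_eq] at hlim
  exact hlim.congr fun N ↦ (hsum N).tsum_eq

/-- If the moments of a bounded nonnegative function `f` tend to zero, then `{f ≥ 1}` has measure
zero. -/
theorem apply_one_le_eq_zero_of_tendsto_moment (hf : Measurable f)
    (hb : ∀ᵐ x ∂μ.variation, 0 ≤ f x ∧ f x ≤ b)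
    (h : Tendsto (fun n : ℕ ↦ ∫ᵛ x, f x ^ n ∂•μ) atTop (𝓝 0)) : μ {x | 1 ≤ f x} = 0 := by
  have hlt : MeasurableSet {x | f x < 1} := measurableSet_lt hf measurable_const
  have heq : MeasurableSet {x | f x = 1} := measurableSet_eq_fun hf measurable_const
  -- Pointwise, `exp (-c * f ^ N)` tends to `1`, `exp (-c)` or `0` as `f < 1`, `f = 1` or `f > 1`.
  -- Two values of `c` then isolate the atom `{f = 1}`.
  have key (c : ℝ) (hc : 0 < c) :
      μ univ = μ {x | f x < 1} + Real.exp (-c) * μ {x | f x = 1} := by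
    refine tendsto_nhds_unique (tendsto_integral_exp_neg_pow hf hb h (-c)) ?_
    have hi : ∫ᵛ x, ({x | f x < 1}.indicator (fun _ ↦ (1 : ℝ)) x +
        {x | f x = 1}.indicator (fun _ ↦ Real.exp (-c)) x) ∂•μ
        = μ {x | f x < 1} + Real.exp (-c) * μ {x | f x = 1} := by
      rw [VectorMeasure.integral_fun_add ((integrable_const _).indicator hlt)
        ((integrable_const _).indicator heq), VectorMeasure.integral_indicator_const _ hlt,
        VectorMeasure.integral_indicator_const _ heq]
      simp
    rw [← hi]
    refine VectorMeasure.tendsto_integral_of_dominated_convergence (fun _ ↦ 1)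
      (fun N ↦ by fun_prop) (integrable_const _) (fun N ↦ ?_) ?_
    · filter_upwards [hb] with x hx
      rw [Real.norm_eq_abs, Real.abs_exp, Real.exp_le_one_iff]
      have := pow_nonneg hx.1 N
      nlinarith
    · filter_upwards [hb] with x hx
      rcases lt_trichotomy (f x) 1 with h1 | h1 | h1
      · have := ((tendsto_pow_atTop_nhds_zero_of_lt_one hx.1 h1).const_mul (-c))
        simpa [h1, h1.ne, Function.comp_def] using (Real.continuous_exp.tendsto _).comp this
      · simp [h1]
      · have := (tendsto_pow_atTop_atTop_of_one_lt h1).const_mul_atTop_of_neg (neg_lt_zero.2 hc)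
        simp only [indicator, mem_ofPred_eq, h1.ne', h1.not_gt, if_false, add_zero]
        exact Real.tendsto_exp_atBot.comp this
  have h1 := key 1 one_pos
  have h2 := key 2 two_pos
  have hne : Real.exp (-1) - Real.exp (-2) ≠ 0 :=
    sub_ne_zero.2 fun hc ↦ by norm_num [Real.exp_eq_exp] at hc
  have h3 : μ {x | f x = 1} = 0 := by
    refine (mul_eq_zero.1 (?_ : (Real.exp (-1) - Real.exp (-2)) * _ = 0)).resolve_left hne
    linarith
  have h4 : {x | 1 ≤ f x} = {x | f x < 1}ᶜ := by ext; simp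
  rw [h4, VectorMeasure.of_compl hlt, h1, h3]
  ring

end Moments

/-- A signed measure on the line carried by `(-∞, s)` that vanishes on `(-∞, t]` for every
`t < s` is zero. -/
theorem eq_zero_of_apply_Iic_eq_zero {μ : SignedMeasure ℝ} {s : ℝ}
    (hs : μ.variation (Ici s) = 0) (h : ∀ t < s, μ (Iic t) = 0) : μ = 0 := by
  have hsub {A : Set ℝ} (hA : A ⊆ Ici s) : μ A = 0 :=
    μ.apply_eq_zero_of_variation_eq_zero (measure_mono_null hA hs)
  have hcompl {A : Set ℝ} (hA : MeasurableSet A) (hAs : Aᶜ ⊆ Ici s) : μ A = μ univ := by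
    rw [← compl_compl A, VectorMeasure.of_compl hA.compl, hsub hAs, sub_zero]
  -- The half-lines `Iic (u n)` with `u n ↑ s` exhaust the carrier.
  have huniv : μ univ = 0 := by
    obtain ⟨u, hu, hus, hlim⟩ := exists_seq_strictMono_tendsto s
    have h1 := μ.tendsto_vectorMeasure_iUnion_atTop_nat (s := fun n ↦ Iic (u n))
      (fun i j hij ↦ Iic_subset_Iic.2 (hu.monotone hij)) fun _ ↦ measurableSet_Iic
    have h2 : μ (⋃ n, Iic (u n)) = μ univ := by
      refine hcompl (MeasurableSet.iUnion fun _ ↦ measurableSet_Iic) fun x hx ↦ ?_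
      simp only [compl_iUnion, compl_Iic, mem_iInter, mem_Ioi] at hx
      exact le_of_tendsto' hlim fun n ↦ (hx n).le
    rw [h2] at h1
    simp only [h _ (hus _)] at h1
    exact (tendsto_nhds_unique h1 tendsto_const_nhds)
  refine VectorMeasure.ext_of_generateFrom (range Iic) ?_
    (BorelSpace.measurable_eq.trans (borel_eq_generateFrom_Iic ℝ)) isPiSystem_Iic (by simpa using huniv)
  rintro _ ⟨t, rfl⟩
  rcases lt_or_ge t s with hts | hts
  · simpa using h t hts
  · rw [hcompl measurableSet_Iic fun x (hx : ¬x ≤ t) ↦ hts.trans (not_le.1 hx).le, huniv]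
    rfl

/-- For odd `k`, the moments of orders `k * n` of a nonzero signed measure on `(a, -1)` are
unbounded above. -/
theorem exists_lt_moment {a : ℝ} {k : ℕ} (hk : Odd k) {μ : SignedMeasure ℝ}
    (hμ : μ ∈ realMeasuresOn (Ioo a (-1))) (hμ0 : μ ≠ 0) (C : ℝ) :
    ∃ n : ℕ, C < ∫ᵛ x, x ^ (k * n) ∂•μ := by
  by_contra! hC
  refine hμ0 ?_
  have hvar : μ.variation (Ioo a (-1))ᶜ = 0 := by
    rw [← SignedMeasure.totalVariation_eq_variation]
    exact hμ
  have hae : ∀ᵐ x ∂μ.variation, x ∈ Ioo a (-1) := hvar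
  have hmono : StrictMono fun x : ℝ ↦ x ^ k := hk.strictMono_pow
  simp only [pow_mul] at hC
  have hb : ∀ᵐ x ∂μ.variation, -(-a ^ k) ≤ x ^ k ∧ x ^ k ≤ 0 := hae.mono fun x hx ↦ by
    rw [neg_neg]
    exact ⟨(hmono hx.1).le, hk.pow_nonpos (by linarith [hx.2])⟩
  have hmeas : Measurable fun x : ℝ ↦ x ^ k := measurable_id.pow_const k
  obtain ⟨K, hK⟩ := exists_abs_moment_le_of_moment_le hmeas hb hC
  refine eq_zero_of_apply_Iic_eq_zero (s := -1)
    (measure_mono_null (fun x hx ↦ fun hx' ↦ ?_) hvar) fun t ht ↦ ?_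
  · exact hx'.2.not_ge hx
  have htk : t ^ k < -1 := by simpa [hk.neg_one_pow] using hmono ht
  have hset : Iic t = {x : ℝ | 1 ≤ (t ^ k)⁻¹ * x ^ k} := by
    ext x
    have : t ^ k < 0 := by linarith
    rw [mem_Iic, mem_ofPred_eq, inv_mul_eq_div, one_le_div_of_neg this]
    exact hmono.le_iff_le.symm
  rw [hset]
  refine apply_one_le_eq_zero_of_tendsto_moment (b := (t ^ k)⁻¹ * a ^ k) (hmeas.const_mul _)
    (hb.mono fun x hx ↦ ?_) ?_
  · have : (t ^ k)⁻¹ ≤ 0 := inv_nonpos.2 (by linarith)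
    exact ⟨mul_nonneg_of_nonpos_of_nonpos this hx.2,
      mul_le_mul_of_nonpos_left (by linarith [hx.1]) this⟩
  · have hr : |(t ^ k)⁻¹| < 1 := by
      rw [abs_inv]
      exact inv_lt_one_of_one_lt₀ (lt_abs.2 (Or.inr (by linarith)))
    have h1 : Tendsto (fun n : ℕ ↦ K * ((n : ℝ) * |(t ^ k)⁻¹| ^ n + |(t ^ k)⁻¹| ^ n)) atTop
        (𝓝 0) := by
      simpa using ((tendsto_self_mul_const_pow_of_lt_one (abs_nonneg _) hr).add
        (tendsto_pow_atTop_nhds_zero_of_lt_one (abs_nonneg _) hr)).const_mul K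
    refine squeeze_zero_norm (fun n ↦ ?_) h1
    simp only [mul_pow]
    have h2 := VectorMeasure.integral_fun_smul (μ := μ) (B := ContinuousLinearMap.lsmul ℝ ℝ)
      ((t ^ k)⁻¹ ^ n) fun x : ℝ ↦ (x ^ k) ^ n
    simp only [smul_eq_mul] at h2
    rw [h2, norm_mul, norm_pow, Real.norm_eq_abs, Real.norm_eq_abs]
    calc _ ≤ |(t ^ k)⁻¹| ^ n * (K * (n + 1)) := by gcongr; exact hK n
      _ = _ := by ring

theorem mainTheorem12 (a : ℝ) (ha : a < -1) (k : ℕ) (hk : Odd k)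
    (μ : MeasureTheory.SignedMeasure ℝ) (hμ : μ ∈ realMeasuresOn (Set.Ioo a (-1))) (hμ0 : μ ≠ 0) :
    (⨆ n : ℕ, ((∫ᵛ x, x ^ (k * n) ∂•μ : ℝ) : EReal)) = ⊤ ∧
      (⨅ n : ℕ, ((∫ᵛ x, x ^ (k * n) ∂•μ : ℝ) : EReal)) = ⊥ := by
  constructor
  · refine iSup_eq_top.2 fun b hb ↦ ?_
    obtain ⟨n, hn⟩ := exists_lt_moment hk hμ hμ0 b.toReal
    exact ⟨n, (EReal.le_coe_toReal hb.ne).trans_lt (EReal.coe_lt_coe_iff.2 hn)⟩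
  · refine iInf_eq_bot.2 fun b hb ↦ ?_
    -- The infimum is the supremum statement for `-μ`.
    have hμ' : -μ ∈ realMeasuresOn (Ioo a (-1)) := by
      change (-μ).totalVariation _ = 0
      rw [SignedMeasure.totalVariation_neg]
      exact hμ
    obtain ⟨n, hn⟩ := exists_lt_moment hk hμ' (neg_ne_zero.2 hμ0) (-b.toReal)
    rw [VectorMeasure.integral_neg_vectorMeasure, neg_lt_neg_iff] at hn
    exact ⟨n, (EReal.coe_lt_coe_iff.2 hn).trans_le (EReal.coe_toReal_le hb.ne')⟩
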